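/- **Morse's Lemma with Parameters.** Let $k$ be an algebraically closed field of characteristic $p\ge 0$. Let $R$ be a complete local $k$-algebra with residue field $k$, that is, a commutative local $k$-algebra with maximal ideal $\mathfrak m$ such that $R$ is $\mathfrak m$-adically complete and separated and the structure map $k\to R/\mathfrak m$ is an isomorphism. Let $x=(x_1,\dots,x_n)$ be indeterminates, let $F\in R[[x]]$, and let $f\in k[[x]]$ be the image of $F$ under coefficientwise reduction modulo $\mathfrak m$. Suppose that $f\in\langle x\rangle^2=\langle x_1,\dots,x_n\rangle^2$ and that the Hessian matrix $\left(\frac{\partial^2 f}{\partial x_i\,\partial x_j}(0)\right)_{1\le i,j\le n}$ has rank $r$. Then $r$ is even if $p=2$. Put $$q=\begin{cases}x_1^2+x_2^2+\dots+x_r^2 & \text{if } p\neq 2,\\ x_1x_2+x_3x_4+\dots+x_{r-1}x_r & \text{if } p=2.\end{cases}$$ Then there exist a power series $h\in R[[x_{r+1},\dots,x_n]]$ and an automorphism of $R[[x]]$ as a local $R$-algebra that sends $F$ to $q+h$. -/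

import Mathlib

/-- The Hessian matrix at the origin of a power series `f` in `n` variables. -/
noncomputable def hessianAtOrigin {k : Type*} [Field k] {n : ℕ}
    (f : MvPowerSeries (Fin n) k) : Matrix (Fin n) (Fin n) k :=
  Matrix.of fun i j =>
    MvPowerSeries.constantCoeff (MvPowerSeries.pderiv k i (MvPowerSeries.pderiv k j f))

/-- The standard quadratic form in the first `r` of `n` variables in characteristic `p`:
`x₁ ^ 2 + ⋯ + x_r ^ 2` if `p ≠ 2`, and `x₁ x₂ + x₃ x₄ + ⋯ + x_{r-1} x_r` if `p = 2`
(for `r` even). The variable `x_{i+1}` is `X i` with `i : Fin n`. -/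
noncomputable def stdQuadric (p n r : ℕ) (R : Type*) [CommRing R] : MvPowerSeries (Fin n) R :=
  if p = 2 then
    ∑ i : Fin n, ∑ j : Fin n,
      if Even (i : ℕ) ∧ (j : ℕ) = (i : ℕ) + 1 ∧ (j : ℕ) < r then
        MvPowerSeries.X i * MvPowerSeries.X j else 0
  else
    ∑ i : Fin n, if (i : ℕ) < r then MvPowerSeries.X i ^ 2 else 0

/-- The inclusion `R[[x_{r+1}, …, x_n]] → R[[x_1, …, x_n]]`. -/
noncomputable def lastVarsIncl (n r : ℕ) (R : Type*) [CommRing R] :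
    MvPowerSeries {i : Fin n // r ≤ (i : ℕ)} R →ₐ[R] MvPowerSeries (Fin n) R :=
  MvPowerSeries.rename Subtype.val

/-! Give the maximal ideal weight 2 and each variable weight 1. After a linear change of variables
over `k`, the series becomes `q + h₀ + e`: `h₀` is a constant plus squares of the last variables,
and `e` has weight at least 3, because linear coefficients lie in the maximal ideal
(`sub_quadratic_mem_weightFiltration`). The rank is that of the polar form, which splits into
hyperbolic planes when `p = 2`, hence is even there (`exists_matrix_normalForm`).

A substitution `x ↦ x + u`, with `u` of weight 2 and supported on the first `r` indices, fixes `h₀`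
and turns `q` into `q(x) + B(x, u) + q(u)`, `B` being the polar form. Put `w(u) = q(u) + e(x + u)`
and write `w(u) = ∑ x_j w_j + (series in the last variables)`, with `j` among the first `r` indices.
Since `B` pairs these variables perfectly, `B(x, u) = -∑ x_j w_j` amounts to `u_i = -c⁻¹ w_{π i}`, a
fixed point equation for `u`. Its right side contracts the filtration, so completeness solves it
(`exists_fixedPoint_weightFiltration`, `exists_algEquiv_eq_quadratic_add`). -/

open MvPowerSeries Finsupp

/-! ### The weight filtration, substitution and fixed points -/

section Filtration

variable {σ R : Type*} [CommRing R]

/-- The ideal of power series of weight at least `N`, where the ideal `I` of the coefficient ring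
has weight `2` and each variable has weight `1`. -/
def weightFiltration (σ : Type*) {R : Type*} [CommRing R] (I : Ideal R) (N : ℕ) :
    Ideal (MvPowerSeries σ R) where
  -- The exponent is `⌈(N - |α|) / 2⌉`; truncated subtraction makes the condition void once `|α| ≥
  -- N`.
  carrier := {f | ∀ α : σ →₀ ℕ, coeff α f ∈ I ^ ((N - α.degree + 1) / 2)}
  add_mem' ha hb α := by
    rw [map_add]
    exact add_mem (ha α) (hb α)
  zero_mem' α := by simp
  smul_mem' c f hf α := by
    classical
    rw [smul_eq_mul, coeff_mul]
    refine sum_mem fun x hx => Ideal.mul_mem_left _ _ (Ideal.pow_le_pow_right ?_ (hf x.2))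
    have := congrArg Finsupp.degree (Finset.HasAntidiagonal.mem_antidiagonal.1 hx)
    rw [map_add] at this
    omega

theorem weightFiltration_zero (I : Ideal R) : weightFiltration σ I 0 = ⊤ :=
  eq_top_iff.2 fun f _ α => by simp

theorem weightFiltration_anti (I : Ideal R) : Antitone (weightFiltration σ I) :=
  fun _ _ h _ hf α => Ideal.pow_le_pow_right (by omega) (hf α)

theorem mul_mem_weightFiltration {I : Ideal R} {M N : ℕ} {f g : MvPowerSeries σ R}
    (hf : f ∈ weightFiltration σ I M) (hg : g ∈ weightFiltration σ I N) :
    f * g ∈ weightFiltration σ I (M + N) := by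
  classical
  intro α
  rw [coeff_mul]
  refine sum_mem fun x hx => ?_
  have h := Ideal.mul_mem_mul (hf x.1) (hg x.2)
  rw [← pow_add] at h
  refine Ideal.pow_le_pow_right ?_ h
  have := congrArg Finsupp.degree (Finset.HasAntidiagonal.mem_antidiagonal.1 hx)
  rw [map_add] at this
  omega

theorem X_mem_weightFiltration (I : Ideal R) (i : σ) : X i ∈ weightFiltration σ I 1 := by
  classical
  intro α
  rw [coeff_X]
  split_ifs with h
  · simp [h]
  · exact zero_mem _

theorem C_mem_weightFiltration {I : Ideal R} {j : ℕ} {c : R} (hc : c ∈ I ^ j) :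
    (C c : MvPowerSeries σ R) ∈ weightFiltration σ I (2 * j) := by
  classical
  intro α
  rw [coeff_C]
  split_ifs with h
  · exact Ideal.pow_le_pow_right (by simp [h]; omega) hc
  · exact zero_mem _

theorem Finsupp.induction_add_single {motive : (σ →₀ ℕ) → Prop} (zero : motive 0)
    (add_single : ∀ α i, motive α → motive (α + single i 1)) (α : σ →₀ ℕ) : motive α := by
  induction h : α.degree generalizing α with
  | zero => rwa [(degree_eq_zero_iff α).1 h]
  | succ d ih =>
    obtain ⟨i, hi⟩ : ∃ i, α i ≠ 0 := by
      by_contra! h0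
      simp [show α = 0 from Finsupp.ext h0] at h
    have hα : α - single i 1 + single i 1 = α :=
      tsub_add_cancel_of_le (single_le_iff.2 (Nat.one_le_iff_ne_zero.2 hi))
    have hd := congrArg Finsupp.degree hα
    rw [map_add, degree_single] at hd
    rw [← hα]
    exact add_single _ _ (ih _ (by omega))

theorem aeval_monomial_add_single (u : σ → MvPowerSeries σ R) (α : σ →₀ ℕ) (i : σ) :
    MvPolynomial.aeval u (MvPolynomial.monomial (α + single i 1) (1 : R)) =
      MvPolynomial.aeval u (MvPolynomial.monomial α (1 : R)) * u i := by
  rw [← mul_one (1 : R), MvPolynomial.monomial_mul.symm, map_mul, mul_one]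
  congr 1
  exact MvPolynomial.aeval_X u i

theorem aeval_monomial_eq_C_mul (u : σ → MvPowerSeries σ R) (α : σ →₀ ℕ) (c : R) :
    MvPolynomial.aeval u (MvPolynomial.monomial α c) =
      C c * MvPolynomial.aeval u (MvPolynomial.monomial α (1 : R)) := by
  rw [← mul_one c, ← MvPolynomial.C_mul_monomial, map_mul, mul_one]
  congr 1
  exact MvPolynomial.aeval_C u c

theorem aeval_monomial_mem_weightFiltration {I : Ideal R} {u : σ → MvPowerSeries σ R}
    (hu : ∀ i, u i ∈ weightFiltration σ I 1) (α : σ →₀ ℕ) :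
    MvPolynomial.aeval u (MvPolynomial.monomial α (1 : R)) ∈ weightFiltration σ I α.degree := by
  induction α using Finsupp.induction_add_single with
  | zero => simp [weightFiltration_zero]
  | add_single α i ih =>
    rw [aeval_monomial_add_single, map_add, degree_single]
    exact mul_mem_weightFiltration ih (hu i)

/-- Telescoping: replacing one factor of weight 1 by a difference of weight `M + 1` gains `M`. -/
theorem aeval_monomial_sub_mem_weightFiltration {I : Ideal R} {M : ℕ}
    {u v : σ → MvPowerSeries σ R} (hu : ∀ i, u i ∈ weightFiltration σ I 1)
    (hv : ∀ i, v i ∈ weightFiltration σ I 1)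
    (huv : ∀ i, u i - v i ∈ weightFiltration σ I (M + 1)) (α : σ →₀ ℕ) :
    MvPolynomial.aeval u (MvPolynomial.monomial α (1 : R)) -
      MvPolynomial.aeval v (MvPolynomial.monomial α (1 : R)) ∈
        weightFiltration σ I (α.degree + M) := by
  induction α using Finsupp.induction_add_single with
  | zero => simp
  | add_single α i ih =>
    have key : ∀ a b c d : MvPowerSeries σ R, a * b - c * d = a * (b - d) + (a - c) * d := by
      intros; ring
    rw [aeval_monomial_add_single, aeval_monomial_add_single, key, map_add, degree_single]
    refine add_mem ?_ ?_
    · refine weightFiltration_anti I ?_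
        (mul_mem_weightFiltration (aeval_monomial_mem_weightFiltration hu α) (huv i))
      omega
    · refine weightFiltration_anti I ?_ (mul_mem_weightFiltration ih (hv i))
      omega

theorem aeval_mem_weightFiltration {I : Ideal R} {N : ℕ} {u : σ → MvPowerSeries σ R}
    (hu : ∀ i, u i ∈ weightFiltration σ I 1) {p : MvPolynomial σ R}
    (hp : (p : MvPowerSeries σ R) ∈ weightFiltration σ I N) :
    MvPolynomial.aeval u p ∈ weightFiltration σ I N := by
  rw [p.as_sum, map_sum]
  refine sum_mem fun α _ => ?_
  rw [aeval_monomial_eq_C_mul]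
  have h := hp α
  rw [MvPolynomial.coeff_coe] at h
  refine weightFiltration_anti I ?_ (mul_mem_weightFiltration (C_mem_weightFiltration h)
    (aeval_monomial_mem_weightFiltration hu α))
  omega

theorem aeval_sub_aeval_mem_weightFiltration {I : Ideal R} {M N : ℕ}
    {u v : σ → MvPowerSeries σ R} (hu : ∀ i, u i ∈ weightFiltration σ I 1)
    (hv : ∀ i, v i ∈ weightFiltration σ I 1)
    (huv : ∀ i, u i - v i ∈ weightFiltration σ I (M + 1)) {p : MvPolynomial σ R}
    (hp : (p : MvPowerSeries σ R) ∈ weightFiltration σ I N) :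
    MvPolynomial.aeval u p - MvPolynomial.aeval v p ∈ weightFiltration σ I (N + M) := by
  rw [p.as_sum, map_sum, map_sum, ← Finset.sum_sub_distrib]
  refine sum_mem fun α _ => ?_
  rw [aeval_monomial_eq_C_mul, aeval_monomial_eq_C_mul v, ← mul_sub]
  have h := hp α
  rw [MvPolynomial.coeff_coe] at h
  refine weightFiltration_anti I ?_ (mul_mem_weightFiltration (C_mem_weightFiltration h)
    (aeval_monomial_sub_mem_weightFiltration hu hv huv α))
  omega

theorem sub_truncTotal_mem_weightFiltration [Finite σ] (I : Ideal R) (N : ℕ)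
    (f : MvPowerSeries σ R) :
    f - (truncTotal N f : MvPolynomial σ R) ∈ weightFiltration σ I N := by
  intro α
  rw [map_sub, MvPolynomial.coeff_coe, coeff_truncTotal_eq_ite]
  split_ifs with h
  · simp
  · simp [Nat.sub_eq_zero_of_le (not_lt.1 h)]

theorem eq_zero_of_forall_mem_weightFiltration {I : Ideal R} [IsHausdorff I R]
    {f : MvPowerSeries σ R} (hf : ∀ N, f ∈ weightFiltration σ I N) : f = 0 := by
  ext α
  refine IsHausdorff.haus ‹_› _ fun j => ?_
  rw [SModEq.zero, smul_eq_mul, Ideal.mul_top]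
  have := hf (α.degree + 2 * j) α
  rwa [show (α.degree + 2 * j - α.degree + 1) / 2 = j by omega] at this

/-- The coefficient at `α` is `I`-adically Cauchy along the indices `|α| + 2j`, where membership in
the filtration means membership in `I ^ j`. -/
theorem exists_limit_weightFiltration {I : Ideal R} [IsPrecomplete I R]
    (a : ℕ → MvPowerSeries σ R) (ha : ∀ N, a (N + 1) - a N ∈ weightFiltration σ I N) :
    ∃ L, ∀ N, L - a N ∈ weightFiltration σ I N := by
  have hle : ∀ M N, M ≤ N → a N - a M ∈ weightFiltration σ I M := by
    intro M N h
    induction N, h using Nat.le_induction with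
    | base => simp
    | succ N h ih =>
      rw [← sub_add_sub_cancel _ (a N)]
      exact add_mem (weightFiltration_anti I h (ha N)) ih
  have hcoeff : ∀ α : σ →₀ ℕ, ∃ L : R, ∀ j, L - coeff α (a (α.degree + 2 * j)) ∈ I ^ j := by
    intro α
    obtain ⟨L, hL⟩ := IsPrecomplete.prec (I := I) inferInstance
      (f := fun j => coeff α (a (α.degree + 2 * j))) (by
        intro i j hij
        rw [SModEq.comm, SModEq.sub_mem, smul_eq_mul, Ideal.mul_top, ← map_sub]
        refine Ideal.pow_le_pow_right ?_ (hle _ _ (by omega) α)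
        omega)
    refine ⟨L, fun j => ?_⟩
    have := (hL j).symm
    rwa [SModEq.sub_mem, smul_eq_mul, Ideal.mul_top] at this
  choose L hL using hcoeff
  obtain ⟨L, hL⟩ : ∃ L : MvPowerSeries σ R,
      ∀ α j, coeff α L - coeff α (a (α.degree + 2 * j)) ∈ I ^ j := ⟨fun α => L α, hL⟩
  refine ⟨L, fun N α => ?_⟩
  rw [map_sub, ← sub_add_sub_cancel _
    (coeff α (a (α.degree + 2 * ((N - α.degree + 1) / 2)))), ← map_sub]
  refine add_mem (hL α _) ?_
  rcases le_total N α.degree with h | h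
  · simp [Nat.sub_eq_zero_of_le h]
  · exact hle N _ (by omega) α

theorem eq_of_forall_sub_mem_weightFiltration {I : Ideal R} [IsHausdorff I R]
    {f g : MvPowerSeries σ R} (h : ∀ N, f - g ∈ weightFiltration σ I N) : f = g :=
  sub_eq_zero.1 (eq_zero_of_forall_mem_weightFiltration h)

theorem coe_sub_mvPolynomial (p q : MvPolynomial σ R) :
    ((p - q : MvPolynomial σ R) : MvPowerSeries σ R) = p - q :=
  map_sub MvPolynomial.coeToMvPowerSeries.ringHom p q

/-- The `u i` may have nonzero constant terms in `I`, so substitution is defined by continuity from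
polynomials. The limit is unique, and this yields the ring axioms by approximation. -/
theorem exists_algHom_weightFiltration [Finite σ] {I : Ideal R} [IsAdicComplete I R]
    {u : σ → MvPowerSeries σ R} (hu : ∀ i, u i ∈ weightFiltration σ I 1) :
    ∃ Φ : MvPowerSeries σ R →ₐ[R] MvPowerSeries σ R,
      (∀ N, ∀ f ∈ weightFiltration σ I N, Φ f ∈ weightFiltration σ I N) ∧
        ∀ i, Φ (X i) = u i := by
  have hex : ∀ f : MvPowerSeries σ R, ∃ y, ∀ N (p : MvPolynomial σ R),
      f - p ∈ weightFiltration σ I N → y - MvPolynomial.aeval u p ∈ weightFiltration σ I N := by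
    intro f
    obtain ⟨y, hy⟩ := exists_limit_weightFiltration (I := I)
      (fun N => MvPolynomial.aeval u (truncTotal N f)) (fun N => by
        rw [← map_sub]
        refine aeval_mem_weightFiltration hu ?_
        rw [coe_sub_mvPolynomial, ← sub_sub_sub_cancel_left _ _ f]
        exact sub_mem (sub_truncTotal_mem_weightFiltration I N f)
          (weightFiltration_anti I N.le_succ (sub_truncTotal_mem_weightFiltration I (N + 1) f)))
    refine ⟨y, fun N p hp => ?_⟩
    rw [← sub_add_sub_cancel _ (MvPolynomial.aeval u (truncTotal N f)), ← map_sub]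
    refine add_mem (hy N) (aeval_mem_weightFiltration hu ?_)
    rw [coe_sub_mvPolynomial, ← sub_sub_sub_cancel_left _ _ f]
    exact sub_mem hp (sub_truncTotal_mem_weightFiltration I N f)
  choose Φ hΦ using hex
  have huniq : ∀ f y : MvPowerSeries σ R, (∀ N, ∃ p : MvPolynomial σ R,
      f - p ∈ weightFiltration σ I N ∧ y - MvPolynomial.aeval u p ∈ weightFiltration σ I N) → Φ f = y := by
    intro f y h
    refine eq_of_forall_sub_mem_weightFiltration (I := I) fun N => ?_
    obtain ⟨p, hp, hy⟩ := h N
    rw [← sub_sub_sub_cancel_right _ _ (MvPolynomial.aeval u p)]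
    exact sub_mem (hΦ f N p hp) hy
  have hpoly : ∀ p : MvPolynomial σ R, Φ p = MvPolynomial.aeval u p := fun p =>
    huniq _ _ fun N => ⟨p, by simp, by simp⟩
  have htrunc := sub_truncTotal_mem_weightFiltration (σ := σ) I
  have hmul : ∀ N (a b c d : MvPowerSeries σ R), a - c ∈ weightFiltration σ I N →
      b - d ∈ weightFiltration σ I N → a * b - c * d ∈ weightFiltration σ I N := by
    intro N a b c d hac hbd
    rw [show a * b - c * d = a * (b - d) + (a - c) * d by ring]
    exact add_mem (Ideal.mul_mem_left _ _ hbd) (Ideal.mul_mem_right _ _ hac)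
  refine ⟨{ toFun := Φ, map_one' := ?_, map_mul' := ?_, map_zero' := ?_, map_add' := ?_,
            commutes' := ?_ }, ?_, ?_⟩
  · simpa using hpoly 1
  · refine fun f g => huniq _ _ fun N => ⟨truncTotal N f * truncTotal N g, ?_, ?_⟩
    · rw [MvPolynomial.coe_mul]
      exact hmul _ _ _ _ _ (htrunc N f) (htrunc N g)
    · rw [map_mul]
      exact hmul _ _ _ _ _ (hΦ f N _ (htrunc N f)) (hΦ g N _ (htrunc N g))
  · simpa using hpoly 0
  · refine fun f g => huniq _ _ fun N => ⟨truncTotal N f + truncTotal N g, ?_, ?_⟩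
    · rw [MvPolynomial.coe_add, add_sub_add_comm]
      exact add_mem (htrunc N f) (htrunc N g)
    · rw [map_add, add_sub_add_comm]
      exact add_mem (hΦ f N _ (htrunc N f)) (hΦ g N _ (htrunc N g))
  · intro r
    simpa [MvPowerSeries.algebraMap_apply] using hpoly (MvPolynomial.C r)
  · intro N f hf
    simpa using hΦ f N 0 (by simpa using hf)
  · intro i
    simpa using hpoly (MvPolynomial.X i)

theorem algHom_coe_eq_aeval {Φ : MvPowerSeries σ R →ₐ[R] MvPowerSeries σ R}
    {u : σ → MvPowerSeries σ R} (hu : ∀ i, Φ (X i) = u i) (p : MvPolynomial σ R) :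
    Φ p = MvPolynomial.aeval u p := by
  have : Φ.comp (MvPolynomial.coeToMvPowerSeries.algHom R) = MvPolynomial.aeval u :=
    MvPolynomial.algHom_ext fun i => by simp [hu]
  simpa using DFunLike.congr_fun this p

/-- Truncation reduces to polynomials: both maps keep the tail in weight `N + M`. -/
theorem algHom_sub_mem_weightFiltration [Finite σ] {I : Ideal R} {M N : ℕ}
    {Φ Ψ : MvPowerSeries σ R →ₐ[R] MvPowerSeries σ R}
    (hΦ : ∀ N, ∀ f ∈ weightFiltration σ I N, Φ f ∈ weightFiltration σ I N)
    (hΨ : ∀ N, ∀ f ∈ weightFiltration σ I N, Ψ f ∈ weightFiltration σ I N)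
    (h : ∀ i, Φ (X i) - Ψ (X i) ∈ weightFiltration σ I (M + 1))
    {f : MvPowerSeries σ R} (hf : f ∈ weightFiltration σ I N) :
    Φ f - Ψ f ∈ weightFiltration σ I (N + M) := by
  have ht := sub_truncTotal_mem_weightFiltration I (N + M) f
  set p := truncTotal (N + M) f
  have hp : (p : MvPowerSeries σ R) ∈ weightFiltration σ I N := by
    rw [← sub_sub_cancel f (p : MvPowerSeries σ R)]
    exact sub_mem hf (weightFiltration_anti I (by omega) ht)
  have h1 := aeval_sub_aeval_mem_weightFiltration (fun i => hΦ 1 _ (X_mem_weightFiltration I i))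
    (fun i => hΨ 1 _ (X_mem_weightFiltration I i)) h hp
  rw [← algHom_coe_eq_aeval (fun _ => rfl), ← algHom_coe_eq_aeval (fun _ => rfl)] at h1
  have h2 := sub_mem (hΦ _ _ ht) (hΨ _ _ ht)
  rw [map_sub, map_sub] at h2
  convert add_mem h1 h2 using 1
  ring

theorem algHom_eq_of_X [Finite σ] {I : Ideal R} [IsHausdorff I R]
    {Φ Ψ : MvPowerSeries σ R →ₐ[R] MvPowerSeries σ R}
    (hΦ : ∀ N, ∀ f ∈ weightFiltration σ I N, Φ f ∈ weightFiltration σ I N)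
    (hΨ : ∀ N, ∀ f ∈ weightFiltration σ I N, Ψ f ∈ weightFiltration σ I N)
    (h : ∀ i, Φ (X i) = Ψ (X i)) : Φ = Ψ := by
  refine AlgHom.ext fun f => eq_of_forall_sub_mem_weightFiltration (I := I) fun N => ?_
  have := algHom_sub_mem_weightFiltration (N := 0) (M := N) (f := f) hΦ hΨ
    (fun i => by simp [h]) (by simp [weightFiltration_zero])
  rwa [zero_add] at this

/-- A map on tuples of power series that contracts the weight filtration has a fixed point, which
lies in the submodule of weight at least `K` as soon as this submodule is stable. -/
theorem exists_fixedPoint_weightFiltration {ι : Type*} {I : Ideal R} [IsAdicComplete I R] {K : ℕ}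
    (T : (ι → MvPowerSeries σ R) → ι → MvPowerSeries σ R)
    (hT : ∀ u, (∀ i, u i ∈ weightFiltration σ I K) → ∀ i, T u i ∈ weightFiltration σ I K)
    (hTc : ∀ N u v, (∀ i, u i ∈ weightFiltration σ I K) → (∀ i, v i ∈ weightFiltration σ I K) →
      (∀ i, u i - v i ∈ weightFiltration σ I (K + N)) →
        ∀ i, T u i - T v i ∈ weightFiltration σ I (K + N + 1)) :
    ∃ u, (∀ i, u i ∈ weightFiltration σ I K) ∧ T u = u := by
  let a : ℕ → ι → MvPowerSeries σ R := fun t => T^[t] 0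
  have hsucc : ∀ t, a (t + 1) = T (a t) := fun t => Function.iterate_succ_apply' T t 0
  have haK : ∀ t i, a t i ∈ weightFiltration σ I K := by
    intro t
    induction t with
    | zero => exact fun i => zero_mem _
    | succ t ih => rw [hsucc]; exact hT _ ih
  have hstep : ∀ t i, a (t + 1) i - a t i ∈ weightFiltration σ I (K + t) := by
    intro t
    induction t with
    | zero => exact fun i => sub_mem (haK _ i) (haK _ i)
    | succ t ih =>
      rw [hsucc (t + 1)]
      nth_rw 2 [hsucc t]
      exact hTc t _ _ (haK _) (haK _) ih
  have hlim : ∀ i, ∃ L, ∀ t, L - a t i ∈ weightFiltration σ I (K + t) := by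
    intro i
    obtain ⟨L, hL⟩ := exists_limit_weightFiltration (I := I) (fun t => a t i) fun t =>
      weightFiltration_anti I (by omega) (hstep t i)
    refine ⟨L, fun t => ?_⟩
    -- The limit is only known to weight `t` at stage `t`; passing through stage `t + K` recovers
    -- weight `K + t`.
    have hgo : ∀ s, a (t + s) i - a t i ∈ weightFiltration σ I (K + t) := by
      intro s
      induction s with
      | zero => simp
      | succ s ih =>
        rw [← sub_add_sub_cancel _ (a (t + s) i)]
        exact add_mem (weightFiltration_anti I (by omega) (hstep (t + s) i)) ih
    rw [← sub_add_sub_cancel _ (a (t + K) i)]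
    exact add_mem (weightFiltration_anti I (by omega) (hL (t + K))) (hgo K)
  choose L hL using hlim
  have hLK : ∀ i, L i ∈ weightFiltration σ I K := fun i => by
    rw [← sub_add_cancel (L i) (a 0 i)]
    exact add_mem (hL i 0) (haK 0 i)
  refine ⟨L, hLK, funext fun i => eq_of_forall_sub_mem_weightFiltration (I := I) fun N => ?_⟩
  rw [← sub_sub_sub_cancel_right _ _ (a (N + 1) i)]
  refine sub_mem ?_ (weightFiltration_anti I (by omega) (hL i (N + 1)))
  rw [hsucc]
  exact weightFiltration_anti I (by omega) (hTc N _ _ hLK (haK N) (fun i => hL i N) i)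

/-- `Φ - id` raises weight by 1. Thus a kernel element has arbitrarily high weight, and `g ↦ y + g -
Φ g` is a contraction whose fixed point is a preimage of `y`. -/
theorem algHom_bijective_of_sub_X_mem [Finite σ] {I : Ideal R} [IsAdicComplete I R]
    {Φ : MvPowerSeries σ R →ₐ[R] MvPowerSeries σ R}
    (hΦ : ∀ N, ∀ f ∈ weightFiltration σ I N, Φ f ∈ weightFiltration σ I N)
    (h : ∀ i, Φ (X i) - X i ∈ weightFiltration σ I 2) : Function.Bijective Φ := by
  have hsub : ∀ N, ∀ f ∈ weightFiltration σ I N, Φ f - f ∈ weightFiltration σ I (N + 1) :=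
    fun N f hf => algHom_sub_mem_weightFiltration (Ψ := AlgHom.id R _) (M := 1) hΦ
      (fun _ _ h => h) h hf
  refine ⟨(injective_iff_map_eq_zero Φ).2 fun f hf => ?_, fun y => ?_⟩
  · refine eq_zero_of_forall_mem_weightFiltration (I := I) fun N => ?_
    induction N with
    | zero => simp [weightFiltration_zero]
    | succ N ih => simpa [hf] using hsub N f ih
  · obtain ⟨g, -, hg⟩ := exists_fixedPoint_weightFiltration (ι := Unit) (I := I) (K := 0)
      (fun g i => y + g i - Φ (g i)) (by simp [weightFiltration_zero]) (by
        intro N u v _ _ h i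
        have := neg_mem (hsub _ _ (h i))
        rw [map_sub] at this
        convert this using 1
        ring)
    refine ⟨g (), ?_⟩
    have := congrFun hg ()
    linear_combination -this

end Filtration

/-! ### Normal forms of quadratic forms over an algebraically closed field -/

section NormalForm

/-- The index paired with `i` by the polar form of the standard quadratic form in
characteristic `p`. -/
def stdPartner (p i : ℕ) : ℕ :=
  if p = 2 then if Even i then i + 1 else i - 1 else i

theorem stdPartner_stdPartner (p i : ℕ) : stdPartner p (stdPartner p i) = i := by
  unfold stdPartner
  grind

theorem stdPartner_lt {p r i : ℕ} (hr : p = 2 → Even r) (hi : i < r) : stdPartner p i < r := by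
  unfold stdPartner
  grind

theorem stdPartner_two_add_two (i : ℕ) : stdPartner 2 (i + 2) = stdPartner 2 i + 2 := by
  unfold stdPartner
  grind

/-- The coefficient of the polar form of the standard quadratic form in characteristic `p`. -/
def stdPolarCoeff (p : ℕ) (k : Type*) [CommRing k] : k := if p = 2 then 1 else 2

theorem stdPolarCoeff_ne_zero {k : Type*} [Field k] (p : ℕ) [CharP k p] :
    stdPolarCoeff p k ≠ 0 := by
  unfold stdPolarCoeff
  split_ifs with h
  · exact one_ne_zero
  · exact Ring.two_ne_zero (by rwa [ringChar.eq k p])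

/-- The family `e` is a basis in which the quadratic form `v ↦ b v v` has rank `r` and agrees with
the standard quadratic form up to squares of the coordinates of index at least `r`. -/
structure IsNormalFamily (p : ℕ) {k V : Type*} [Field k] [AddCommGroup V] [Module k V]
    (b : LinearMap.BilinForm k V) (n r : ℕ) (e : Fin n → V) : Prop where
  le : r ≤ n
  even : p = 2 → Even r
  linearIndependent : LinearIndependent k e
  polar : ∀ i j, b (e i) (e j) + b (e j) (e i) =
    if (i : ℕ) < r ∧ (j : ℕ) = stdPartner p i then stdPolarCoeff p k else 0
  diag : ∀ i : Fin n, (i : ℕ) < r → b (e i) (e i) = if p = 2 then 0 else 1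

variable {k V : Type*} [Field k] [AddCommGroup V] [Module k V]

theorem isNormalFamily_zero [FiniteDimensional k V] {p : ℕ} {b : LinearMap.BilinForm k V}
    (h : ∀ v w, b v w + b w v = 0) {n : ℕ} (hn : Module.finrank k V = n) :
    ∃ e, IsNormalFamily p b n 0 e := by
  refine ⟨Module.finBasisOfFinrankEq k V hn, Nat.zero_le _, by simp,
    (Module.finBasisOfFinrankEq k V hn).linearIndependent, ?_, by simp⟩
  intro i j
  simp [h]

theorem not_mem_span_of_map_eq_zero {ι : Type*} {e : ι → V} (l : V →ₗ[k] k) {v : V}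
    (hv : l v ≠ 0) (he : ∀ i, l (e i) = 0) : v ∉ Submodule.span k (Set.range e) := by
  intro h
  have : Submodule.span k (Set.range e) ≤ LinearMap.ker l :=
    Submodule.span_le.2 (by rintro _ ⟨i, rfl⟩; exact he i)
  exact hv (this h)

theorem IsNormalFamily.cons {p : ℕ} (hp : p ≠ 2) {b : LinearMap.BilinForm k V} {n r : ℕ}
    {v : V} (hv : b v v = 1) (h2 : (2 : k) ≠ 0) {W : Submodule k V}
    (hW : ∀ w ∈ W, b v w + b w v = 0)
    {e : Fin n → W} (he : IsNormalFamily p (b.restrict W) n r e) :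
    IsNormalFamily p b (n + 1) (r + 1) (Fin.cons v fun i => (e i : V)) where
  le := Nat.succ_le_succ he.le
  even := fun h => absurd h hp
  linearIndependent := by
    refine linearIndependent_finCons.2 ⟨he.linearIndependent.map' W.subtype W.ker_subtype, ?_⟩
    refine not_mem_span_of_map_eq_zero (b v + b.flip v) ?_ fun i => hW _ (e i).2
    simpa [hv, one_add_one_eq_two] using h2
  polar := by
    have hp' := he.polar
    simp only [stdPartner, hp, if_false, stdPolarCoeff] at hp' ⊢
    intro i j
    refine Fin.cases ?_ (fun i => ?_) i <;> refine Fin.cases ?_ (fun j => ?_) j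
    · simp [hv, one_add_one_eq_two]
    · simpa using hW _ (e j).2
    · simpa [add_comm] using hW _ (e i).2
    · simpa using hp' i j
  diag := by
    intro i
    refine Fin.cases ?_ (fun i => ?_) i
    · simp [hp, hv]
    · simpa using he.diag i

theorem IsNormalFamily.cons_cons [CharP k 2] {b : LinearMap.BilinForm k V} {n r : ℕ}
    {v w : V} (hv : b v v = 0) (hw : b w w = 0) (hvw : b v w + b w v = 1) {W : Submodule k V}
    (hWv : ∀ x ∈ W, b v x + b x v = 0) (hWw : ∀ x ∈ W, b w x + b x w = 0)
    {e : Fin n → W} (he : IsNormalFamily 2 (b.restrict W) n r e) :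
    IsNormalFamily 2 b (n + 2) (r + 2) (Fin.cons v (Fin.cons w fun i => (e i : V))) where
  le := by have := he.le; omega
  even := fun _ => (he.even rfl).add even_two
  linearIndependent := by
    refine linearIndependent_finCons.2 ⟨linearIndependent_finCons.2
      ⟨he.linearIndependent.map' W.subtype W.ker_subtype, ?_⟩, ?_⟩
    -- Pairing with `v` kills `W` but not `w`; pairing with `w` then kills `w` and `W` but not `v`.
    · refine not_mem_span_of_map_eq_zero (b v + b.flip v) ?_ fun i => hWv _ (e i).2
      simp [hvw]
    · refine not_mem_span_of_map_eq_zero (b w + b.flip w) ?_ fun i => ?_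
      · simp [add_comm, hvw]
      · refine Fin.cases ?_ (fun i => ?_) i
        · simp [hw]
        · simpa using hWw _ (e i).2
  polar := by
    have hp' := he.polar
    have hvw' := add_comm (b v w) (b w v) ▸ hvw
    simp only [stdPolarCoeff, if_true] at hp' ⊢
    intro i j
    refine Fin.cases ?_ (fun i => Fin.cases ?_ (fun i => ?_) i) i <;>
      refine Fin.cases ?_ (fun j => Fin.cases ?_ (fun j => ?_) j) j
    · simp [hv, stdPartner]
    · simp [hvw, stdPartner]
    · simpa [stdPartner] using hWv _ (e j).2
    · simp [hvw', stdPartner]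
    · simp [hw, stdPartner]
    · simpa [stdPartner] using hWw _ (e j).2
    · simpa [stdPartner_two_add_two, add_assoc] using (add_comm _ _).trans (hWv _ (e i).2)
    · have : 1 ≠ stdPartner 2 i + 2 := by omega
      simpa [stdPartner_two_add_two, add_assoc, this] using (add_comm _ _).trans (hWw _ (e i).2)
    · simpa [add_assoc, stdPartner_two_add_two] using hp' i j
  diag := by
    intro i
    refine Fin.cases ?_ (fun i => Fin.cases ?_ (fun i => ?_) i) i
    · simp [hv]
    · simp [hw]
    · simpa [add_assoc] using he.diag i

/-- A root of the quadratic equation `b (v + s w) (v + s w) = 0` gives an isotropic vector; in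
characteristic 2 its pairing with `w` does not depend on `s`. -/
theorem exists_hyperbolic_pair [IsAlgClosed k] [CharP k 2] (b : LinearMap.BilinForm k V) {v w : V}
    (h : b v w + b w v ≠ 0) :
    ∃ x y, b x x = 0 ∧ b y y = 0 ∧ b x y + b y x = 1 := by
  obtain ⟨x, y, hx, hxy⟩ : ∃ x y, b x x = 0 ∧ b x y + b y x ≠ 0 := by
    by_cases hw : b w w = 0
    · exact ⟨w, v, hw, by rwa [add_comm]⟩
    · obtain ⟨s, hs⟩ := IsAlgClosed.exists_eval₂_eq_zero_of_injective (RingHom.id k)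
        Function.injective_id
        (Polynomial.C (b w w) * Polynomial.X ^ 2 +
          Polynomial.C (b v w + b w v) * Polynomial.X + Polynomial.C (b v v))
        (by rw [Polynomial.degree_quadratic hw]; decide)
      refine ⟨v + s • w, w, ?_, ?_⟩
      · simp at hs
        simp
        linear_combination hs
      · have h2 : (2 : k) = 0 := CharTwo.two_eq_zero
        have : b (v + s • w) w + b w (v + s • w) = b v w + b w v := by
          simp
          linear_combination (s * b w w) * h2
        rwa [this]
  set t := b x y + b y x with ht
  have h2 : (2 : k) = 0 := CharTwo.two_eq_zero
  -- Since `x` is isotropic, `y - s x` has value `b y y - s t` and pairing `t` with `x`; take `s =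
  -- t⁻¹ b y y`, then rescale.
  refine ⟨x, t⁻¹ • (y - (t⁻¹ * b y y) • x), hx, ?_, ?_⟩
  · simp only [map_smul, map_sub, LinearMap.smul_apply, LinearMap.sub_apply, smul_eq_mul, hx]
    field_simp
    linear_combination (-(b y y)) * ht
  · simp [hx]
    field_simp
    exact ht.symm

/-- Split off a hyperbolic plane (`p = 2`) or a vector of value 1 (`p ≠ 2`) and recurse on its
orthogonal complement for the polar form. The form `b` need not be symmetric, so every quadratic
form in characteristic 2 is covered. -/
theorem exists_isNormalFamily [IsAlgClosed k] [FiniteDimensional k V] (p : ℕ) [CharP k p] {n : ℕ}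
    (hn : Module.finrank k V = n) (b : LinearMap.BilinForm k V) :
    ∃ r e, IsNormalFamily p b n r e := by
  induction n using Nat.strong_induction_on generalizing V with
  | _ n ih =>
    by_cases h0 : ∀ v w, b v w + b w v = 0
    · exact ⟨0, isNormalFamily_zero h0 hn⟩
    by_cases hp : p = 2
    · subst hp
      push Not at h0
      obtain ⟨v, w, h⟩ := h0
      obtain ⟨v, w, hv, hw, hvw⟩ := exists_hyperbolic_pair b h
      let l : V →ₗ[k] k × k := (b v + b.flip v).prod (b w + b.flip w)
      have hl : LinearMap.range l = ⊤ := by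
        refine LinearMap.range_eq_top.2 fun x => ⟨x.1 • w + x.2 • v, ?_⟩
        ext
        · simp [l, hv, ← mul_add, hvw]
        · simp [l, hw, ← mul_add, add_comm (b w v), hvw]
      have hd := l.finrank_range_add_finrank_ker
      rw [hl, finrank_top, Module.finrank_prod, Module.finrank_self, hn] at hd
      have hker : ∀ x ∈ LinearMap.ker l, b v x + b x v = 0 ∧ b w x + b x w = 0 := by
        intro x hx
        simpa [l] using hx
      obtain ⟨r, e, he⟩ := ih _ (by omega) rfl (b.restrict (LinearMap.ker l))
      obtain rfl : Module.finrank k (LinearMap.ker l) + 2 = n := by omega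
      exact ⟨_, _, he.cons_cons hv hw hvw (fun x hx => (hker x hx).1) fun x hx => (hker x hx).2⟩
    · have h2 : (2 : k) ≠ 0 := Ring.two_ne_zero (by rwa [ringChar.eq k p])
      obtain ⟨v, hv⟩ : ∃ v, b v v = 1 := by
        by_contra! hne
        refine h0 fun v w => ?_
        -- A nonzero value could be rescaled to 1 by a square root; if all values vanish, so does
        -- the polar form.
        have hz : ∀ v, b v v = 0 := by
          intro v
          by_contra hv
          obtain ⟨s, hs⟩ := IsAlgClosed.exists_pow_nat_eq (b v v)⁻¹ two_pos
          refine hne (s • v) ?_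
          simp [← mul_assoc, ← sq, hs, hv]
        have := hz (v + w)
        simpa [hz, add_comm] using this
      let l : V →ₗ[k] k := b v + b.flip v
      have hlv : l v = 2 := by simp [l, hv, one_add_one_eq_two]
      have hl : LinearMap.range l = ⊤ := by
        refine LinearMap.range_eq_top.2 fun x => ⟨(x / 2) • v, ?_⟩
        simp [hlv, h2]
      have hd := l.finrank_range_add_finrank_ker
      rw [hl, finrank_top, Module.finrank_self, hn] at hd
      have hker : ∀ x ∈ LinearMap.ker l, b v x + b x v = 0 := by
        intro x hx
        simpa [l] using hx
      obtain ⟨r, e, he⟩ := ih _ (by omega) rfl (b.restrict (LinearMap.ker l))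
      obtain rfl : Module.finrank k (LinearMap.ker l) + 1 = n := by omega
      exact ⟨_, _, he.cons hp hv h2 hker⟩

theorem exists_perm_stdPartner {p n r : ℕ} (hrn : r ≤ n) (hr : p = 2 → Even r) :
    ∃ π : Equiv.Perm (Fin n), (∀ i : Fin n, (π i : ℕ) < r ↔ (i : ℕ) < r) ∧
      ∀ i : Fin n, (i : ℕ) < r → (π i : ℕ) = stdPartner p i := by
  let f : Fin n → Fin n := fun i =>
    if h : (i : ℕ) < r then ⟨stdPartner p i, (stdPartner_lt hr h).trans_le hrn⟩ else i
  have hf : Function.Involutive f := by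
    intro i
    by_cases h : (i : ℕ) < r
    · simp [f, h, stdPartner_lt hr h, stdPartner_stdPartner]
    · simp [f, h]
  refine ⟨hf.toPerm, fun i => ?_, fun i h => by simp [f, h]⟩
  by_cases h : (i : ℕ) < r
  · simp [f, h, stdPartner_lt hr h]
  · simp [f, h]

/-- Permuting columns by the pairing makes the matrix diagonal. -/
theorem rank_stdPolar {p : ℕ} [CharP k p] {n r : ℕ} (hrn : r ≤ n) (hr : p = 2 → Even r) :
    (Matrix.of fun i j : Fin n => if (i : ℕ) < r ∧ (j : ℕ) = stdPartner p i
      then stdPolarCoeff p k else 0).rank = r := by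
  classical
  obtain ⟨π, -, hπ⟩ := exists_perm_stdPartner hrn hr
  have hG : (Matrix.of fun i j : Fin n => if (i : ℕ) < r ∧ (j : ℕ) = stdPartner p i
      then stdPolarCoeff p k else 0).submatrix (Equiv.refl _) π =
        Matrix.diagonal fun i : Fin n => if (i : ℕ) < r then stdPolarCoeff p k else 0 := by
    ext i j
    simp only [Matrix.submatrix_apply, Equiv.refl_apply, Matrix.of_apply, Matrix.diagonal_apply]
    by_cases hi : (i : ℕ) < r
    · simp [hi, ← hπ i hi, Fin.val_inj, eq_comm]
    · simp [hi]
  rw [← Matrix.rank_submatrix _ (Equiv.refl _) π, hG, Matrix.rank_diagonal]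
  simp [stdPolarCoeff_ne_zero p, Fintype.card_subtype, Fin.card_filter_val_lt, hrn]

/-- Congruence by an invertible matrix preserves the rank of `a + aᵀ`, which identifies the `r`
found by induction. -/
theorem exists_matrix_normalForm [IsAlgClosed k] (p : ℕ) [CharP k p] {n : ℕ}
    (a : Matrix (Fin n) (Fin n) k) :
    ∃ P : Matrix (Fin n) (Fin n) k, IsUnit P.det ∧ (p = 2 → Even (a + a.transpose).rank) ∧
      (∀ i j, (P.transpose * a * P) i j + (P.transpose * a * P) j i =
        if (i : ℕ) < (a + a.transpose).rank ∧ (j : ℕ) = stdPartner p i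
          then stdPolarCoeff p k else 0) ∧
      ∀ i : Fin n, (i : ℕ) < (a + a.transpose).rank →
        (P.transpose * a * P) i i = if p = 2 then 0 else 1 := by
  obtain ⟨r, e, he⟩ := exists_isNormalFamily p (Module.finrank_fin_fun k) (Matrix.toBilin' a)
  let P : Matrix (Fin n) (Fin n) k := Matrix.transpose (Matrix.of e)
  have hP : IsUnit P.det := by
    rw [Matrix.det_transpose, ← Matrix.isUnit_iff_isUnit_det,
      ← Matrix.linearIndependent_rows_iff_isUnit]
    exact he.linearIndependent
  have hb : ∀ i j, (P.transpose * a * P) i j = Matrix.toBilin' a (e i) (e j) := by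
    intro i j
    rw [Matrix.toBilin'_apply', Matrix.dotProduct_mulVec, Matrix.mul_apply']
    congr 1
  have hrank : (a + a.transpose).rank = r := by
    rw [← rank_stdPolar (k := k) (p := p) he.le he.even, 
      ← Matrix.rank_mul_eq_left_of_isUnit_det P _ hP,
      ← Matrix.rank_mul_eq_right_of_isUnit_det P.transpose _ (by rwa [Matrix.det_transpose])]
    congr 1
    ext i j
    rw [Matrix.of_apply, ← he.polar, ← hb, ← hb, ← Matrix.mul_assoc, Matrix.mul_add, Matrix.add_mul,
      Matrix.add_apply]
    congr 1
    rw [← Matrix.transpose_apply (P.transpose * a * P)]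
    simp only [Matrix.transpose_mul, Matrix.transpose_transpose, Matrix.mul_assoc]
  rw [hrank]
  exact ⟨P, hP, he.even, fun i j => by rw [hb, hb, he.polar], fun i hi => by rw [hb, he.diag i hi]⟩

end NormalForm

/-! ### Division by the first variables -/

section Division

variable {R : Type*} [CommRing R] {n : ℕ}

/-- The quotient by `X j` of the part of `g` made of the monomials in which `j` is the least
occurring variable. -/
noncomputable def divLeastX (j : Fin n) (g : MvPowerSeries (Fin n) R) : MvPowerSeries (Fin n) R :=
  fun β => if ∀ l < j, β l = 0 then coeff (β + single j 1) g else 0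

theorem coeff_divLeastX (j : Fin n) (g : MvPowerSeries (Fin n) R) (β : Fin n →₀ ℕ) :
    coeff β (divLeastX j g) = if ∀ l < j, β l = 0 then coeff (β + single j 1) g else 0 :=
  rfl

theorem divLeastX_sub (j : Fin n) (g g' : MvPowerSeries (Fin n) R) :
    divLeastX j (g - g') = divLeastX j g - divLeastX j g' := by
  ext β
  simp only [coeff_divLeastX, map_sub]
  split_ifs <;> simp

theorem divLeastX_mem_weightFiltration {I : Ideal R} {N : ℕ} (j : Fin n)
    {g : MvPowerSeries (Fin n) R} (hg : g ∈ weightFiltration (Fin n) I (N + 1)) :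
    divLeastX j g ∈ weightFiltration (Fin n) I N := by
  intro β
  rw [coeff_divLeastX]
  split_ifs
  · have := hg (β + single j 1)
    rw [map_add, degree_single] at this
    exact Ideal.pow_le_pow_right (by omega) this
  · exact zero_mem _

theorem coeff_X_mul_divLeastX (j : Fin n) (g : MvPowerSeries (Fin n) R) (α : Fin n →₀ ℕ) :
    coeff α (X j * divLeastX j g) = if α j ≠ 0 ∧ ∀ l < j, α l = 0 then coeff α g else 0 := by
  rw [X, coeff_monomial_mul, one_mul, coeff_divLeastX]
  by_cases hj : α j = 0
  · simp [hj]
  · have h1 : single j 1 ≤ α := single_le_iff.2 (Nat.one_le_iff_ne_zero.2 hj)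
    have h2 : (∀ l < j, (α - single j 1 : Fin n →₀ ℕ) l = 0) ↔ ∀ l < j, α l = 0 := by
      refine forall₂_congr fun l hl => ?_
      simp [hl.ne']
    simp only [h1, if_true, h2, tsub_add_cancel_of_le h1, ne_eq, hj, not_false_eq_true, true_and]

theorem mem_range_lastVarsIncl {r : ℕ} {g : MvPowerSeries (Fin n) R}
    (hg : ∀ (α : Fin n →₀ ℕ) (i : Fin n), (i : ℕ) < r → α i ≠ 0 → coeff α g = 0) :
    g ∈ (lastVarsIncl n r R).range := by
  let ε : {i : Fin n // r ≤ (i : ℕ)} ↪ Fin n := Function.Embedding.subtype _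
  refine ⟨killCompl ε g, ?_⟩
  change rename ε (killCompl ε g) = g
  ext α
  by_cases h : α ∈ Set.range (embDomain ε)
  · obtain ⟨β, rfl⟩ := h
    rw [coeff_embDomain_rename, coeff_killCompl]
  · rw [coeff_rename_eq_zero]
    · rw [mem_range_embDomain_iff, Set.not_subset] at h
      obtain ⟨i, hi, hi'⟩ := h
      refine (hg α i ?_ (by simpa using hi)).symm
      by_contra! hri
      exact hi' ⟨⟨i, hri⟩, rfl⟩
    · rintro ⟨β, hβ⟩
      exact h ⟨β, by rw [embDomain_eq_mapDomain, hβ]⟩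

/-- A monomial involving one of the first `r` variables is removed exactly once, through its least
variable. -/
theorem sub_sum_X_mul_divLeastX_mem_range (r : ℕ) (g : MvPowerSeries (Fin n) R) :
    g - ∑ j : Fin n, (if (j : ℕ) < r then X j * divLeastX j g else 0) ∈
      (lastVarsIncl n r R).range := by
  refine mem_range_lastVarsIncl fun α i hi hαi => ?_
  obtain ⟨j, hj, hmin⟩ := wellFounded_lt.has_min {j : Fin n | α j ≠ 0} ⟨i, hαi⟩
  have hji : j ≤ i := not_lt.1 (hmin i hαi)
  have hα : ∀ l < j, α l = 0 := fun l hl => by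
    by_contra h
    exact hmin l h hl
  rw [map_sub, map_sum, Finset.sum_eq_single j, if_pos ((Fin.le_def.1 hji).trans_lt hi),
    coeff_X_mul_divLeastX,
    if_pos ⟨hj, hα⟩, sub_self]
  · intro l _ hlj
    split_ifs
    · rw [coeff_X_mul_divLeastX, if_neg]
      rintro ⟨hl, hl'⟩
      rcases lt_or_gt_of_ne hlj with h | h
      · exact hl (hα l h)
      · exact hj (hl' j h)
    · exact map_zero _
  · simp

end Division

/-! ### Identities for quadratic forms -/

section Quadratic

/-- In the difference the terms at `(i, j)` and `(j, i)` cancel and the diagonal ones vanish, so no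
division by 2 is needed. -/
theorem sum_sum_mul_mul_eq {ι S : Type*} [Fintype ι] [CommRing S] {a b : ι → ι → S}
    (hdiag : ∀ i, a i i = b i i) (hpolar : ∀ i j, a i j + a j i = b i j + b j i) (x : ι → S) :
    ∑ i, ∑ j, a i j * (x i * x j) = ∑ i, ∑ j, b i j * (x i * x j) := by
  classical
  rw [← sub_eq_zero, ← Finset.sum_sub_distrib]
  simp_rw [← Finset.sum_sub_distrib]
  rw [← Fintype.sum_prod_type' (f := fun i j => a i j * (x i * x j) - b i j * (x i * x j))]
  refine Finset.sum_involution (fun y _ => y.swap) ?_ ?_ (by simp) (by simp)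
  · rintro ⟨i, j⟩ -
    simp only [Prod.swap]
    linear_combination (x i * x j) * hpolar i j
  · rintro ⟨i, j⟩ - h hij
    obtain rfl : j = i := congrArg Prod.fst hij
    exact h (by simp [hdiag])

theorem sum_sum_mul_add_mul_add {ι S : Type*} [Fintype ι] [CommRing S] (a : ι → ι → S)
    (x u : ι → S) :
    ∑ i, ∑ j, a i j * ((x i + u i) * (x j + u j)) =
      ∑ i, ∑ j, a i j * (x i * x j) + ∑ i, ∑ j, a i j * (u i * u j) +
        ∑ i, ∑ j, (a i j + a j i) * (x j * u i) := by
  have : ∑ i, ∑ j, a j i * (x j * u i) = ∑ i, ∑ j, a i j * (x i * u j) := Finset.sum_comm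
  simp only [add_mul, Finset.sum_add_distrib, this]
  simp only [← Finset.sum_add_distrib]
  refine Finset.sum_congr rfl fun i _ => Finset.sum_congr rfl fun j _ => ?_
  ring

theorem sum_sum_mul_mul_mulVec {ι S : Type*} [Fintype ι] [CommRing S] (A P : Matrix ι ι S)
    (x : ι → S) :
    ∑ i, ∑ j, A i j * (P.mulVec x i * P.mulVec x j) =
      ∑ i, ∑ j, (P.transpose * A * P) i j * (x i * x j) := by
  have h : ∀ (B : Matrix ι ι S) (y : ι → S),
      ∑ i, ∑ j, B i j * (y i * y j) = y ⬝ᵥ B.mulVec y := by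
    intro B y
    simp only [dotProduct, Matrix.mulVec, Finset.mul_sum]
    refine Finset.sum_congr rfl fun i _ => Finset.sum_congr rfl fun j _ => ?_
    ring
  rw [h, h, Matrix.mulVec_mulVec, ← Matrix.vecMul_transpose, Matrix.mul_assoc,
    Matrix.dotProduct_mulVec, Matrix.dotProduct_mulVec, Matrix.vecMul_vecMul]

end Quadratic

/-! ### Nonlinear and linear coordinate changes -/

section Morse

variable {R : Type*} [CommRing R] {n : ℕ}

/-- A power series that agrees with `q + h₀` up to terms of weight at least `3`, where `q` is a
quadratic form in the first `r` variables whose polar form pairs them perfectly, and `h₀` is a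
diagonal quadratic polynomial in the other variables, can be brought into the form `q + h` with `h`
a power series in the other variables. -/
theorem exists_algEquiv_eq_quadratic_add {I : Ideal R} [IsAdicComplete I R] {r : ℕ}
    (π : Equiv.Perm (Fin n)) (hπ : ∀ i, (π i : ℕ) < r ↔ (i : ℕ) < r) {c : R} (hc : IsUnit c)
    {a : Fin n → Fin n → R}
    (ha : ∀ i j, a i j + a j i = if (i : ℕ) < r ∧ j = π i then c else 0)
    (c₀ : R) (d : Fin n → R) {F : MvPowerSeries (Fin n) R}
    (hF : F - (∑ i, ∑ j, C (a i j) * (X i * X j) +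
      (C c₀ + ∑ i : Fin n, if (i : ℕ) < r then 0 else C (d i) * (X i * X i))) ∈
        weightFiltration (Fin n) I 3) :
    ∃ (h : MvPowerSeries {i : Fin n // r ≤ (i : ℕ)} R)
      (φ : MvPowerSeries (Fin n) R ≃ₐ[R] MvPowerSeries (Fin n) R),
      φ F = ∑ i, ∑ j, C (a i j) * (X i * X j) + lastVarsIncl n r R h := by
  obtain ⟨c', hc'⟩ := hc.exists_left_inv
  set h₀ : MvPowerSeries (Fin n) R :=
    C c₀ + ∑ i : Fin n, if (i : ℕ) < r then 0 else C (d i) * (X i * X i) with hh₀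
  set q : (Fin n → MvPowerSeries (Fin n) R) → MvPowerSeries (Fin n) R :=
    fun u => ∑ i, ∑ j, C (a i j) * (u i * u j) with hq
  change F - (q X + h₀) ∈ _ at hF
  change ∃ h, ∃ φ : MvPowerSeries (Fin n) R ≃ₐ[R] MvPowerSeries (Fin n) R,
    φ F = q X + lastVarsIncl n r R h
  set e := F - (q X + h₀) with he
  have hshift : ∀ u : Fin n → MvPowerSeries (Fin n) R, ∃ Φ :
      MvPowerSeries (Fin n) R →ₐ[R] MvPowerSeries (Fin n) R,
      (∀ i, u i ∈ weightFiltration (Fin n) I 2) →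
        (∀ N, ∀ f ∈ weightFiltration (Fin n) I N, Φ f ∈ weightFiltration (Fin n) I N) ∧
          ∀ i, Φ (X i) = X i + u i := by
    intro u
    by_cases hu : ∀ i, u i ∈ weightFiltration (Fin n) I 2
    · obtain ⟨Φ, hΦ⟩ := exists_algHom_weightFiltration (I := I) (u := fun i => X i + u i)
        fun i => add_mem (X_mem_weightFiltration I i) (weightFiltration_anti I one_le_two (hu i))
      exact ⟨Φ, fun _ => hΦ⟩
    -- A default value, so that `Φ` is defined for every `u`.
    · exact ⟨AlgHom.id R _, fun h => absurd h hu⟩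
  choose Φ hΦ using hshift
  let w : (Fin n → MvPowerSeries (Fin n) R) → MvPowerSeries (Fin n) R := fun u => q u + Φ u e
  have hq2 : ∀ N u v, (∀ i, u i ∈ weightFiltration (Fin n) I 2) →
      (∀ i, v i ∈ weightFiltration (Fin n) I 2) →
      (∀ i, u i - v i ∈ weightFiltration (Fin n) I (2 + N)) →
        q u - q v ∈ weightFiltration (Fin n) I (2 + N + 2) := by
    intro N u v hu hv huv
    simp only [hq, ← Finset.sum_sub_distrib, ← mul_sub]
    refine sum_mem fun i _ => sum_mem fun j _ => Ideal.mul_mem_left _ _ ?_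
    rw [show u i * u j - v i * v j = (u i - v i) * u j + (u j - v j) * v i by ring]
    exact add_mem (mul_mem_weightFiltration (huv i) (hu j))
      (mul_mem_weightFiltration (huv j) (hv i))
  have hw : ∀ u, (∀ i, u i ∈ weightFiltration (Fin n) I 2) →
      w u ∈ weightFiltration (Fin n) I 3 := by
    intro u hu
    refine add_mem ?_ ((hΦ u hu).1 _ _ hF)
    refine weightFiltration_anti I (by norm_num : 3 ≤ 2 + 2) ?_
    exact sum_mem fun i _ => sum_mem fun j _ =>
      Ideal.mul_mem_left _ _ (mul_mem_weightFiltration (hu i) (hu j))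
  -- `w` gains 2 in weight and the division loses 1, so the map below contracts.
  have hwc : ∀ N u v, (∀ i, u i ∈ weightFiltration (Fin n) I 2) →
      (∀ i, v i ∈ weightFiltration (Fin n) I 2) →
      (∀ i, u i - v i ∈ weightFiltration (Fin n) I (2 + N)) →
        w u - w v ∈ weightFiltration (Fin n) I (2 + N + 1 + 1) := by
    intro N u v hu hv huv
    rw [add_sub_add_comm]
    refine add_mem (hq2 N u v hu hv huv) ?_
    refine weightFiltration_anti I (by omega : _ ≤ 3 + (N + 1)) ?_
    refine algHom_sub_mem_weightFiltration (hΦ u hu).1 (hΦ v hv).1 (fun i => ?_) hF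
    rw [(hΦ u hu).2, (hΦ v hv).2, add_sub_add_left_eq_sub]
    exact weightFiltration_anti I (by omega) (huv i)
  obtain ⟨u, hu, hfix⟩ := exists_fixedPoint_weightFiltration (I := I) (K := 2)
    (fun u (i : Fin n) => if (i : ℕ) < r then -(C c' * divLeastX (π i) (w u)) else 0) (by
      intro u hu i
      split_ifs
      · exact neg_mem (Ideal.mul_mem_left _ _ (divLeastX_mem_weightFiltration _ (hw u hu)))
      · exact zero_mem _) (by
      intro N u v hu hv huv i
      split_ifs
      · rw [neg_sub_neg, ← mul_sub, ← divLeastX_sub]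
        refine Ideal.mul_mem_left _ _ (divLeastX_mem_weightFiltration _ ?_)
        rw [← neg_mem_iff, neg_sub]
        exact hwc N u v hu hv huv
      · simp)
  obtain ⟨hfil, hX⟩ := hΦ u hu
  have hbij : Function.Bijective (Φ u) :=
    algHom_bijective_of_sub_X_mem hfil fun i => by simpa [hX] using hu i
  have hu_lt : ∀ i : Fin n, (i : ℕ) < r → u i = -(C c' * divLeastX (π i) (w u)) := fun i hi => by
    have := congrFun hfix i
    rw [if_pos hi] at this
    exact this.symm
  have hu_ge : ∀ i : Fin n, ¬ (i : ℕ) < r → u i = 0 := fun i hi => by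
    rw [← congrFun hfix i, if_neg hi]
  have hC : ∀ s : R, Φ u (C s) = C s := fun s => (Φ u).commutes s
  have hh₀' : Φ u h₀ = h₀ := by
    simp only [hh₀, map_add, map_sum, hC]
    congr 1
    refine Finset.sum_congr rfl fun i _ => ?_
    split_ifs with hi
    · exact map_zero _
    · simp [hC, hX, hu_ge i hi]
  -- The polar form leaves only `c x_{π i} u_i`, and the fixed point equation rewrites it.
  have hlin : ∑ i, ∑ j, (C (a i j) + C (a j i)) * (X j * u i) =
      -∑ j : Fin n, if (j : ℕ) < r then X j * divLeastX j (w u) else 0 := by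
    rw [← Equiv.sum_comp π fun j : Fin n => if (j : ℕ) < r then X j * divLeastX j (w u) else 0,
      ← Finset.sum_neg_distrib]
    refine Finset.sum_congr rfl fun i _ => ?_
    simp only [← map_add, ha, hπ]
    by_cases hi : (i : ℕ) < r
    · simp only [hi, true_and, if_true]
      rw [Finset.sum_eq_single (π i) (by intro j _ hj; simp [hj]) (by simp), if_pos rfl, hu_lt i hi]
      have : (C c' * C c : MvPowerSeries (Fin n) R) = 1 := by rw [← map_mul, hc', map_one]
      linear_combination (-(X (π i) * divLeastX (π i) (w u))) * this
    · simp [hi]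
  have hqX : Φ u (q X) = q X + q u -
      ∑ j : Fin n, if (j : ℕ) < r then X j * divLeastX j (w u) else 0 := by
    simp only [hq, map_sum, map_mul, hC, hX]
    rw [sum_sum_mul_add_mul_add (fun i j => C (a i j)), hlin, sub_eq_add_neg]
  -- All that remains besides `q` is free of the first `r` variables; this is `h`.
  have hrange : h₀ + (w u - ∑ j : Fin n, if (j : ℕ) < r then X j * divLeastX j (w u) else 0) ∈
      (lastVarsIncl n r R).range := by
    refine add_mem (add_mem ?_ (sum_mem fun i _ => ?_)) (sub_sum_X_mul_divLeastX_mem_range r _)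
    · exact (lastVarsIncl n r R).range.algebraMap_mem c₀
    · split_ifs with hi
      · exact zero_mem _
      · have hXi : (X i : MvPowerSeries (Fin n) R) ∈ (lastVarsIncl n r R).range :=
          ⟨X ⟨i, not_lt.1 hi⟩, rename_X _ _⟩
        exact mul_mem ((lastVarsIncl n r R).range.algebraMap_mem (d i)) (mul_mem hXi hXi)
  obtain ⟨h, hh⟩ := hrange
  refine ⟨h, AlgEquiv.ofBijective (Φ u) hbij, ?_⟩
  change Φ u F = q X + lastVarsIncl n r R h
  rw [show F = q X + h₀ + e by rw [he]; ring, map_add, map_add, hqX, hh₀',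
    show lastVarsIncl n r R h = _ from hh]
  simp only [w]
  ring

/-- The substitution by `P⁻¹` is inverse, which need only be checked on the variables. -/
theorem exists_linear_algEquiv {I : Ideal R} [IsAdicComplete I R] {P : Matrix (Fin n) (Fin n) R}
    (hP : IsUnit P.det) :
    ∃ φ : MvPowerSeries (Fin n) R ≃ₐ[R] MvPowerSeries (Fin n) R,
      (∀ N, ∀ f ∈ weightFiltration (Fin n) I N, φ f ∈ weightFiltration (Fin n) I N) ∧
        ∀ i, φ (X i) = ∑ j, C (P i j) * X j := by
  have hex : ∀ Q : Matrix (Fin n) (Fin n) R,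
      ∃ Φ : MvPowerSeries (Fin n) R →ₐ[R] MvPowerSeries (Fin n) R,
      (∀ N, ∀ f ∈ weightFiltration (Fin n) I N, Φ f ∈ weightFiltration (Fin n) I N) ∧
        ∀ i, Φ (X i) = ∑ j, C (Q i j) * X j := fun Q =>
    exists_algHom_weightFiltration fun i => sum_mem fun j _ =>
      Ideal.mul_mem_left _ _ (X_mem_weightFiltration I j)
  have hcomp : ∀ (Q Q' : Matrix (Fin n) (Fin n) R) (_ : Q * Q' = 1)
      (Φ Φ' : MvPowerSeries (Fin n) R →ₐ[R] MvPowerSeries (Fin n) R)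
      (_ : ∀ N, ∀ f ∈ weightFiltration (Fin n) I N, Φ f ∈ weightFiltration (Fin n) I N)
      (_ : ∀ N, ∀ f ∈ weightFiltration (Fin n) I N, Φ' f ∈ weightFiltration (Fin n) I N)
      (_ : ∀ i, Φ (X i) = ∑ j, C (Q i j) * X j) (_ : ∀ i, Φ' (X i) = ∑ j, C (Q' i j) * X j),
      Φ'.comp Φ = AlgHom.id R _ := by
    intro Q Q' hQ Φ Φ' hΦ hΦ' hX hX'
    refine algHom_eq_of_X (I := I) (fun N f hf => hΦ' N _ (hΦ N f hf)) (fun _ _ h => h) fun i => ?_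
    have hC : ∀ s : R, Φ' (C s) = C s := fun s => Φ'.commutes s
    simp only [AlgHom.comp_apply, hX, map_sum, map_mul, hC, hX', Finset.mul_sum, AlgHom.id_apply]
    rw [Finset.sum_comm]
    simp only [← mul_assoc, ← map_mul, ← Finset.sum_mul, ← map_sum, ← Matrix.mul_apply, hQ]
    simp [Matrix.one_apply, apply_ite (C : R → MvPowerSeries (Fin n) R)]
  obtain ⟨Φ, hΦ, hX⟩ := hex P
  obtain ⟨Ψ, hΨ, hX'⟩ := hex P⁻¹
  exact ⟨AlgEquiv.ofAlgHom Φ Ψ (hcomp _ _ (Matrix.nonsing_inv_mul P hP) _ _ hΨ hΦ hX' hX)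
    (hcomp _ _ (Matrix.mul_nonsing_inv P hP) _ _ hΦ hΨ hX hX'), hΦ, hX⟩

end Morse

/-! ### Coefficients of the standard quadric -/

section StdQuadric

/-- The coefficient of `X i * X j` in the standard quadratic form in characteristic `p`. -/
def stdQuadricCoeff (p r : ℕ) (S : Type*) [CommRing S] (i j : ℕ) : S :=
  if p = 2 then if Even i ∧ j = i + 1 ∧ j < r then 1 else 0
  else if i = j ∧ i < r then 1 else 0

theorem stdQuadric_eq_sum (p n r : ℕ) (R : Type*) [CommRing R] :
    stdQuadric p n r R =
      ∑ i : Fin n, ∑ j : Fin n, C (stdQuadricCoeff p r R i j) * (X i * X j) := by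
  unfold stdQuadric stdQuadricCoeff
  split_ifs with hp
  · refine Finset.sum_congr rfl fun i _ => Finset.sum_congr rfl fun j _ => ?_
    split_ifs <;> simp
  · refine Finset.sum_congr rfl fun i _ => ?_
    rw [Finset.sum_eq_single i]
    · split_ifs <;> simp_all [sq]
    · intro j _ hj
      simp [Fin.val_inj, hj.symm]
    · simp

theorem map_stdPolarCoeff (p : ℕ) {S T : Type*} [CommRing S] [CommRing T] (g : S →+* T) :
    g (stdPolarCoeff p S) = stdPolarCoeff p T := by
  unfold stdPolarCoeff
  split_ifs
  · exact map_one g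
  · exact map_ofNat g 2

theorem stdQuadricCoeff_self (p r : ℕ) (S : Type*) [CommRing S] (i : ℕ) :
    stdQuadricCoeff p r S i i = if i < r then if p = 2 then 0 else 1 else 0 := by
  unfold stdQuadricCoeff
  split_ifs <;> simp_all

theorem stdQuadricCoeff_add_swap {p r : ℕ} (hr : p = 2 → Even r) (S : Type*) [CommRing S]
    (i j : ℕ) :
    stdQuadricCoeff p r S i j + stdQuadricCoeff p r S j i =
      if i < r ∧ j = stdPartner p i then stdPolarCoeff p S else 0 := by
  unfold stdQuadricCoeff stdPartner stdPolarCoeff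
  by_cases hp : p = 2
  · have hr' := hr hp
    simp only [hp, if_true]
    by_cases hi : Even i
    · have h1 : ¬(Even j ∧ i = j + 1 ∧ i < r) := by grind
      have h2 : (Even i ∧ j = i + 1 ∧ j < r) ↔ (i < r ∧ j = i + 1) := by grind
      rw [if_neg h1, add_zero, if_pos hi]
      exact if_congr h2 rfl rfl
    · have h1 : (Even j ∧ i = j + 1 ∧ i < r) ↔ (i < r ∧ j = i - 1) := by grind
      simp only [hi, h1, false_and, if_false, zero_add]
  · simp only [hp, if_false]
    by_cases h : i = j
    · subst h
      split_ifs <;> simp_all [one_add_one_eq_two]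
    · simp [h, Ne.symm h]

end StdQuadric

/-! ### The Hessian and the quadratic part -/

section Hessian

variable {k : Type*} [Field k] {n : ℕ}

/-- The upper triangular matrix of the coefficients of degree `2` of a power series. -/
noncomputable def quadraticCoeffMatrix (f : MvPowerSeries (Fin n) k) : Matrix (Fin n) (Fin n) k :=
  Matrix.of fun i j => if i ≤ j then coeff (single i 1 + single j 1) f else 0

/-- The Hessian is the polar matrix of the quadratic part. In characteristic 2 it forgets the
squares, which the triangular matrix retains. -/
theorem hessianAtOrigin_eq (f : MvPowerSeries (Fin n) k) :
    hessianAtOrigin f = quadraticCoeffMatrix f + (quadraticCoeffMatrix f).transpose := by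
  ext i j
  simp only [hessianAtOrigin, quadraticCoeffMatrix, Matrix.of_apply, Matrix.add_apply,
    Matrix.transpose_apply]
  rw [← coeff_zero_eq_constantCoeff_apply, coeff_pderiv, coeff_pderiv, zero_add]
  rcases lt_trichotomy i j with h | rfl | h
  · simp [h.le, not_le.2 h, h.ne]
  · simp
    ring
  · simp [h.le, not_le.2 h, h.ne', add_comm]

theorem exists_eq_single_add_single {α : Fin n →₀ ℕ} (h : α.degree = 2) :
    ∃ i j, i ≤ j ∧ α = single i 1 + single j 1 := by
  have hstep : ∀ (d : ℕ) (β : Fin n →₀ ℕ), β.degree = d + 1 →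
      ∃ i γ, γ.degree = d ∧ β = γ + single i 1 := by
    intro d β hβ
    obtain ⟨i, hi⟩ : ∃ i, β i ≠ 0 := by
      by_contra! h0
      simp [show β = 0 from Finsupp.ext h0] at hβ
    have hγ : β - single i 1 + single i 1 = β :=
      tsub_add_cancel_of_le (single_le_iff.2 (Nat.one_le_iff_ne_zero.2 hi))
    have hd := congrArg Finsupp.degree hγ
    rw [map_add, degree_single] at hd
    exact ⟨i, _, by omega, hγ.symm⟩
  obtain ⟨i, β, hβ, rfl⟩ := hstep 1 α h
  obtain ⟨j, γ, hγ, rfl⟩ := hstep 0 β hβ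
  rw [(degree_eq_zero_iff γ).1 hγ, zero_add]
  rcases le_total j i with hij | hij
  · exact ⟨j, i, hij, rfl⟩
  · exact ⟨i, j, hij, add_comm _ _⟩

theorem coeff_sum_quadraticCoeffMatrix {R : Type*} [CommRing R] [Algebra k R]
    (f : MvPowerSeries (Fin n) k) (α : Fin n →₀ ℕ) :
    coeff α (∑ i, ∑ j, C (algebraMap k R (quadraticCoeffMatrix f i j)) * (X i * X j)) =
      if α.degree = 2 then algebraMap k R (coeff α f) else 0 := by
  have hcoeff : ∀ i j : Fin n, coeff α (X i * X j : MvPowerSeries (Fin n) R) =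
      if α = single i 1 + single j 1 then 1 else 0 := by
    intro i j
    rw [X, X, monomial_mul_monomial, coeff_monomial, one_mul]
  simp only [map_sum, coeff_C_mul, hcoeff, mul_ite, mul_one, mul_zero]
  split_ifs with h
  · obtain ⟨i, j, hij, rfl⟩ := exists_eq_single_add_single h
    rw [Finset.sum_eq_single i, Finset.sum_eq_single j]
    · simp [quadraticCoeffMatrix, hij]
    · intro l _ hl
      rw [if_neg]
      intro h
      exact hl (single_left_injective one_ne_zero (add_left_cancel h)).symm
    · simp
    · intro m _ hm
      refine Finset.sum_eq_zero fun l _ => ?_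
      -- The transposed index pair gives the same monomial, but its entry lies below the diagonal.
      rw [ite_eq_right_iff, single_add_single_eq_single_add_single one_ne_zero one_ne_zero]
      rintro (⟨rfl, -⟩ | ⟨-, rfl, rfl⟩ | ⟨h, -⟩)
      · exact absurd rfl hm
      · simp [quadraticCoeffMatrix, not_le.2 (lt_of_le_of_ne hij hm.symm)]
      · exact absurd h (by norm_num)
    · simp
  · refine Finset.sum_eq_zero fun i _ => Finset.sum_eq_zero fun j _ => if_neg ?_
    rintro rfl
    simp [degree_single] at h

/-- For the ideal `⊥` the weight filtration is the filtration by order. -/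
theorem coeff_eq_zero_of_mem_span_X_sq {f : MvPowerSeries (Fin n) k}
    (hf : f ∈ (Ideal.span (Set.range (X : Fin n → MvPowerSeries (Fin n) k))) ^ 2)
    {α : Fin n →₀ ℕ} (hα : α.degree < 2) : coeff α f = 0 := by
  have h1 : Ideal.span (Set.range (X : Fin n → MvPowerSeries (Fin n) k)) ≤
      weightFiltration (Fin n) ⊥ 1 :=
    Ideal.span_le.2 (by rintro _ ⟨i, rfl⟩; exact X_mem_weightFiltration ⊥ i)
  have h2 : f ∈ weightFiltration (Fin n) (⊥ : Ideal k) (1 + 1) := by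
    rw [sq] at hf
    exact Ideal.mul_le.2 (fun g hg g' hg' => mul_mem_weightFiltration (h1 hg) (h1 hg')) hf
  have := Ideal.pow_le_self (by omega) (h2 α)
  simpa using this

end Hessian

/-! ### Assembly of the proof -/

theorem sub_quadratic_mem_weightFiltration {k : Type*} [Field k] {R : Type*} [CommRing R]
    [IsLocalRing R] [Algebra k R] {n : ℕ} {F : MvPowerSeries (Fin n) R}
    {f : MvPowerSeries (Fin n) k}
    (hFf : MvPowerSeries.map (IsLocalRing.residue R) F =
      MvPowerSeries.map (algebraMap k (IsLocalRing.ResidueField R)) f)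
    (hf : f ∈ (Ideal.span (Set.range (X : Fin n → MvPowerSeries (Fin n) k))) ^ 2) :
    F - (C (constantCoeff F) +
      ∑ i, ∑ j, C (algebraMap k R (quadraticCoeffMatrix f i j)) * (X i * X j)) ∈
        weightFiltration (Fin n) (IsLocalRing.maximalIdeal R) 3 := by
  have hmem : ∀ α, coeff α F - algebraMap k R (coeff α f) ∈ IsLocalRing.maximalIdeal R := by
    intro α
    have := congrArg (coeff α) hFf
    rw [coeff_map, coeff_map,
      IsScalarTower.algebraMap_apply k R (IsLocalRing.ResidueField R)] at this
    exact Ideal.Quotient.eq.1 this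
  intro α
  rw [map_sub, map_add, coeff_sum_quadraticCoeffMatrix, coeff_C]
  by_cases h0 : α = 0
  · simp [h0]
  · rw [if_neg h0, zero_add]
    have hd : α.degree ≠ 0 := fun h => h0 ((degree_eq_zero_iff α).1 h)
    -- Weight 3 asks for one factor of the maximal ideal in degrees 1 and 2, and nothing in degree 3
    -- or more.
    split_ifs with h2
    · simpa [h2] using hmem α
    · rw [sub_zero]
      rcases Nat.lt_or_ge α.degree 2 with h | h
      · have := hmem α
        rw [coeff_eq_zero_of_mem_span_X_sq hf h, map_zero, sub_zero] at this
        simpa [show α.degree = 1 by omega] using this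
      · simp [show 3 - α.degree = 0 by omega]

theorem mainTheorem5 {k : Type*} [Field k] [IsAlgClosed k] (p : ℕ) [CharP k p]
    {R : Type*} [CommRing R] [IsLocalRing R] [Algebra k R]
    [IsAdicComplete (IsLocalRing.maximalIdeal R) R]
    (hk : Function.Bijective (algebraMap k (IsLocalRing.ResidueField R)))
    (n r : ℕ) (F : MvPowerSeries (Fin n) R) (f : MvPowerSeries (Fin n) k)
    (hFf : MvPowerSeries.map (IsLocalRing.residue R) F =
      MvPowerSeries.map (algebraMap k (IsLocalRing.ResidueField R)) f)
    (hf : f ∈ (Ideal.span (Set.range (MvPowerSeries.X : Fin n → MvPowerSeries (Fin n) k))) ^ 2)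
    (hr : (hessianAtOrigin f).rank = r) :
    (p = 2 → Even r) ∧
      ∃ (h : MvPowerSeries {i : Fin n // r ≤ (i : ℕ)} R)
        (φ : MvPowerSeries (Fin n) R ≃ₐ[R] MvPowerSeries (Fin n) R),
        φ F = stdQuadric p n r R + lastVarsIncl n r R h := by
  have hrn : r ≤ n := by
    rw [← hr]
    exact Matrix.rank_le_width _
  have hF := sub_quadratic_mem_weightFiltration hFf hf
  rw [hessianAtOrigin_eq] at hr
  set a := quadraticCoeffMatrix f
  obtain ⟨P, hP, heven, hpolar, hdiag⟩ := exists_matrix_normalForm p a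
  rw [hr] at heven hpolar hdiag
  refine ⟨heven, ?_⟩
  -- The base change comes from `k`, so the normal form holds exactly over `R`.
  obtain ⟨φ, hφ, hX⟩ := exists_linear_algEquiv (I := IsLocalRing.maximalIdeal R)
    (P := P.map (algebraMap k R)) (by
      rw [← RingHom.mapMatrix_apply, ← RingHom.map_det]
      exact hP.map _)
  set N := P.transpose * a * P with hN
  have hC : ∀ s : R, φ (C s) = C s := fun s => φ.commutes s
  have hquad : φ (∑ i, ∑ j, C (algebraMap k R (a i j)) * (X i * X j)) =
      ∑ i, ∑ j, C (algebraMap k R (N i j)) * (X i * X j) := by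
    let g : k →+* MvPowerSeries (Fin n) R := C.comp (algebraMap k R)
    have h := sum_sum_mul_mul_mulVec (a.map g) (P.map g) X
    rw [← Matrix.transpose_map, ← Matrix.map_mul, ← Matrix.map_mul] at h
    simp only [map_sum, map_mul, hC, hX]
    exact h
  -- Polar forms agree, and so do diagonals up to index `r`; later squares go into `h₀`.
  have hnormal : ∑ i, ∑ j, C (algebraMap k R (N i j)) * (X i * X j) =
      ∑ i : Fin n, ∑ j : Fin n, C (stdQuadricCoeff p r R i j) * (X i * X j) +
        ∑ i : Fin n, if (i : ℕ) < r then 0 else C (algebraMap k R (N i i)) * (X i * X i) := by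
    have hdiag' : ∀ i : Fin n, C (algebraMap k R (N i i)) =
        C (stdQuadricCoeff p r R i i) +
          if (i : ℕ) < r then 0 else (C (algebraMap k R (N i i)) : MvPowerSeries (Fin n) R) := by
      intro i
      rw [stdQuadricCoeff_self]
      split_ifs with hi hp
      · simp [hdiag i hi, hp]
      · simp [hdiag i hi, hp]
      · simp
    rw [sum_sum_mul_mul_eq (b := fun i j : Fin n => C (stdQuadricCoeff p r R i j) +
      if i = j then if (i : ℕ) < r then 0 else C (algebraMap k R (N i i)) else 0)]
    · simp [add_mul, Finset.sum_add_distrib, ite_mul]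
    · intro i
      rw [if_pos rfl, ← hdiag']
    · intro i j
      by_cases hij : i = j
      · subst hij
        rw [if_pos rfl, ← hdiag']
      · rw [if_neg hij, if_neg (Ne.symm hij), add_zero, add_zero, ← map_add, ← map_add, ← map_add,
          stdQuadricCoeff_add_swap heven, hpolar]
        rw [← map_stdPolarCoeff p (algebraMap k R)]
        split_ifs <;> simp
  obtain ⟨π, hπ, hπp⟩ := exists_perm_stdPartner hrn heven
  have hc : IsUnit (stdPolarCoeff p R) := by
    rw [← map_stdPolarCoeff p (algebraMap k R)]
    exact (stdPolarCoeff_ne_zero p).isUnit.map _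
  obtain ⟨h, ψ, hψ⟩ := exists_algEquiv_eq_quadratic_add (I := IsLocalRing.maximalIdeal R)
    (F := φ F) (r := r) π hπ hc (a := fun i j => stdQuadricCoeff p r R i j) (by
      intro i j
      rw [stdQuadricCoeff_add_swap heven]
      refine if_congr (and_congr_right fun hi => ?_) rfl rfl
      rw [← hπp i hi, Fin.val_inj]) (constantCoeff F) (fun i => algebraMap k R (N i i)) (by
      have := hφ _ _ hF
      rw [map_sub, map_add, hC, hquad, hnormal] at this
      convert this using 2
      ring)
  exact ⟨h, φ.trans ψ, by rw [stdQuadric_eq_sum]; exact hψ⟩
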